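/- Let $X$ and $Y$ be Banach spaces over $\mathbb{K}\in\{\mathbb{R},\mathbb{C}\}$ with $Y\neq\{0\}$. Let $X\hat{\otimes}_\pi Y$ be their projective tensor product, that is, the completion of $X\otimes Y$ under the norm $\|u\|_\pi=\inf\{\sum_{i=1}^n\|x_i\|\,\|y_i\| : u=\sum_{i=1}^n x_i\otimes y_i\}$. A Banach space $E$ has the Daugavet property if $\|\mathrm{Id}+T\|=1+\|T\|$ for every rank-one bounded linear operator $T\colon E\to E$. A slice of a set $A\subseteq E$ is a nonempty intersection of $A$ with an open half-space $\{x : \operatorname{Re} x^*(x)>c\}$, where $x^*\in E^*$ and $c\in\mathbb{R}$. A bounded set $A\subseteq E$ is slicely countably determined (SCD) if there is a sequence $(V_n)_{n\in\mathbb{N}}$ of slices of $A$ such that $A\subseteq\overline{\operatorname{conv}}(B)$ for every $B\subseteq A$ that intersects all the sets $V_n$. Suppose that the closed unit ball $B_Y$ is an SCD set and that $X\hat{\otimes}_\pi Y$ has the Daugavet property. Then $X$ has the Daugavet property. -/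

import Mathlib

open scoped TensorProduct

noncomputable section

/-- The algebraic tensor product `X ⊗ Y`, as a separate type on which the projective norm is put. -/
def AlgTensor (𝕜 X Y : Type*) [RCLike 𝕜] [NormedAddCommGroup X] [NormedSpace 𝕜 X]
    [NormedAddCommGroup Y] [NormedSpace 𝕜 Y] : Type _ :=
  X ⊗[𝕜] Y

namespace AlgTensor

variable {𝕜 X Y : Type*} [RCLike 𝕜] [NormedAddCommGroup X] [NormedSpace 𝕜 X]
  [NormedAddCommGroup Y] [NormedSpace 𝕜 Y]

instance : AddCommGroup (AlgTensor 𝕜 X Y) := inferInstanceAs (AddCommGroup (X ⊗[𝕜] Y))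

instance : Module 𝕜 (AlgTensor 𝕜 X Y) := inferInstanceAs (Module 𝕜 (X ⊗[𝕜] Y))

variable (𝕜) in
/-- The elementary tensor `x ⊗ y`. -/
def tmul (x : X) (y : Y) : AlgTensor 𝕜 X Y := x ⊗ₜ[𝕜] y

/-- The values `∑ ‖x i‖ * ‖y i‖` over all the finite representations `u = ∑ x i ⊗ y i`. -/
def costs (u : AlgTensor 𝕜 X Y) : Set ℝ :=
  {r | ∃ (n : ℕ) (x : Fin n → X) (y : Fin n → Y),
    u = ∑ i, tmul 𝕜 (x i) (y i) ∧ r = ∑ i, ‖x i‖ * ‖y i‖}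

/-- The projective norm. -/
def projNorm (u : AlgTensor 𝕜 X Y) : ℝ := sInf (costs u)

theorem nonneg_of_mem_costs {u : AlgTensor 𝕜 X Y} {r : ℝ} (h : r ∈ costs u) : 0 ≤ r := by
  obtain ⟨n, x, y, -, rfl⟩ := h
  positivity

theorem bddBelow_costs (u : AlgTensor 𝕜 X Y) : BddBelow (costs u) :=
  ⟨0, fun _ h => nonneg_of_mem_costs h⟩

theorem zero_mem_costs : (0 : ℝ) ∈ costs (0 : AlgTensor 𝕜 X Y) :=
  ⟨0, Fin.elim0, Fin.elim0, by simp, by simp⟩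

theorem add_mem_costs {u v : AlgTensor 𝕜 X Y} {r s : ℝ} (hr : r ∈ costs u) (hs : s ∈ costs v) :
    r + s ∈ costs (u + v) := by
  obtain ⟨n, x, y, rfl, rfl⟩ := hr
  obtain ⟨m, x', y', rfl, rfl⟩ := hs
  exact ⟨n + m, Fin.append x x', Fin.append y y', by simp [Fin.sum_univ_add],
    by simp [Fin.sum_univ_add]⟩

theorem smul_mem_costs (a : 𝕜) {u : AlgTensor 𝕜 X Y} {r : ℝ} (hr : r ∈ costs u) :
    ‖a‖ * r ∈ costs (a • u) := by
  obtain ⟨n, x, y, rfl, rfl⟩ := hr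
  refine ⟨n, fun i => a • x i, y, ?_, ?_⟩
  · rw [Finset.smul_sum]
    exact Finset.sum_congr rfl fun i _ => TensorProduct.smul_tmul' a (x i) (y i)
  · rw [Finset.mul_sum]
    exact Finset.sum_congr rfl fun i _ => by rw [norm_smul, mul_assoc]

theorem tmul_mem_costs (x : X) (y : Y) : ‖x‖ * ‖y‖ ∈ costs (tmul 𝕜 x y) :=
  ⟨1, fun _ => x, fun _ => y, by simp, by simp⟩

theorem costs_nonempty (u : AlgTensor 𝕜 X Y) : (costs u).Nonempty := by
  refine TensorProduct.induction_on (motive := fun v : X ⊗[𝕜] Y => (costs (𝕜 := 𝕜) v).Nonempty)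
    u ?_ ?_ ?_
  · exact ⟨0, zero_mem_costs⟩
  · exact fun x y => ⟨_, tmul_mem_costs x y⟩
  · rintro v w ⟨r, hr⟩ ⟨s, hs⟩
    exact ⟨r + s, add_mem_costs hr hs⟩

theorem projNorm_zero : projNorm (0 : AlgTensor 𝕜 X Y) = 0 :=
  le_antisymm (csInf_le (bddBelow_costs _) zero_mem_costs)
    (le_csInf (costs_nonempty _) fun _ h => nonneg_of_mem_costs h)

theorem projNorm_add_le (u v : AlgTensor 𝕜 X Y) :
    projNorm (u + v) ≤ projNorm u + projNorm v := by
  refine le_of_forall_pos_le_add fun ε hε => ?_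
  obtain ⟨r, hr, hr'⟩ := exists_lt_of_csInf_lt (costs_nonempty u)
    (lt_add_of_pos_right (sInf (costs u)) (half_pos hε))
  obtain ⟨s, hs, hs'⟩ := exists_lt_of_csInf_lt (costs_nonempty v)
    (lt_add_of_pos_right (sInf (costs v)) (half_pos hε))
  have := csInf_le (bddBelow_costs _) (add_mem_costs hr hs)
  unfold projNorm
  linarith

theorem projNorm_smul_le (a : 𝕜) (u : AlgTensor 𝕜 X Y) :
    projNorm (a • u) ≤ ‖a‖ * projNorm u := by
  unfold projNorm
  rw [← smul_eq_mul, ← Real.sInf_smul_of_nonneg (norm_nonneg a)]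
  refine le_csInf ((costs_nonempty u).smul_set) ?_
  rintro _ ⟨r, hr, rfl⟩
  exact csInf_le (bddBelow_costs _) (smul_mem_costs a hr)

/-- The projective norm as a Mathlib seminorm. -/
def projSeminorm : Seminorm 𝕜 (AlgTensor 𝕜 X Y) :=
  Seminorm.ofSMulLE projNorm projNorm_zero projNorm_add_le projNorm_smul_le

instance : SeminormedAddCommGroup (AlgTensor 𝕜 X Y) :=
  (projSeminorm (𝕜 := 𝕜) (X := X) (Y := Y)).toAddGroupSeminorm.toSeminormedAddCommGroup

instance : NormedSpace 𝕜 (AlgTensor 𝕜 X Y) where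
  norm_smul_le := projNorm_smul_le

theorem norm_def (u : AlgTensor 𝕜 X Y) :
    ‖u‖ = sInf {r | ∃ (n : ℕ) (x : Fin n → X) (y : Fin n → Y),
      u = ∑ i, tmul 𝕜 (x i) (y i) ∧ r = ∑ i, ‖x i‖ * ‖y i‖} := rfl

end AlgTensor

/-- The projective tensor product of `X` and `Y`: the completion of the algebraic tensor product
under the projective norm. -/
abbrev ProjectiveTensorProduct (𝕜 X Y : Type*) [RCLike 𝕜] [NormedAddCommGroup X]
    [NormedSpace 𝕜 X] [NormedAddCommGroup Y] [NormedSpace 𝕜 Y] : Type _ :=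
  UniformSpace.Completion (AlgTensor 𝕜 X Y)

section Notions

variable (𝕜 : Type*) [RCLike 𝕜] {E : Type*} [NormedAddCommGroup E] [NormedSpace 𝕜 E]

variable (E) in
/-- The Daugavet property: `‖Id + T‖ = 1 + ‖T‖` for all rank-one bounded operators `T`. -/
def HasDaugavetProperty : Prop :=
  ∀ T : E →L[𝕜] E, (T : E →ₗ[𝕜] E).rank = 1 → ‖ContinuousLinearMap.id 𝕜 E + T‖ = 1 + ‖T‖

/-- The closed convex hull (with real coefficients) of a subset of a normed space over `𝕜`, which is
`ℝ` or `ℂ`. -/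
def closedConvHull (B : Set E) : Set E :=
  letI : NormedSpace ℝ E := NormedSpace.restrictScalars ℝ 𝕜 E
  closure (convexHull ℝ B)

/-- `V` is a slice of `A`: a nonempty intersection of `A` with an open half space. (The functional
`f = 0` contributes only `A` itself; a bounded nonempty `A` is a slice of itself anyway when
`E ≠ 0`.) -/
def IsSlice (A V : Set E) : Prop :=
  V.Nonempty ∧ ∃ (f : E →L[𝕜] 𝕜) (c : ℝ), V = {x ∈ A | c < RCLike.re (f x)}

/-- The countable family `V n` of subsets of `A` is determining for `A`. -/
def IsDetermining (A : Set E) (V : ℕ → Set E) : Prop :=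
  (∀ n, V n ⊆ A) ∧
    ∀ B ⊆ A, (∀ n, (B ∩ V n).Nonempty) → A ⊆ closedConvHull 𝕜 B

/-- `A` is a slicely countably determined set. -/
def IsSCD (A : Set E) : Prop :=
  Bornology.IsBounded A ∧ ∃ V : ℕ → Set E, (∀ n, IsSlice 𝕜 A (V n)) ∧ IsDetermining 𝕜 A V

end Notions

end

/-!
The proof transfers the Daugavet equation from `Z = X ⊗̂ Y` to `X` by working with elementary tensors
only.

The unit ball of `Z` is the closed convex hull of the tensors `x ⊗ y` with `‖x‖, ‖y‖ ≤ 1`, so these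
tensors norm every operator on `Z`.  Applied to `Id + φ(·) u`, where `φ = f ⊗ g` with
`‖f‖ = ‖g‖ = 1`, the Daugavet property of `Z` gives `x` and `y` in the unit balls with `f x` and
`g y` close to `1` and `‖u + x ⊗ y‖` close to `‖u‖ + 1`
(`HasDaugavetProperty.exists_tmul_norm_add_gt`).

Let `V n` be determining slices of the unit ball of `Y`, and let `v : X`, `‖y₀‖ = 1`.  Starting from
`u = v ⊗ y₀` and adding one tensor at a time, one gets `x n` with `f (x n)` close to `1` and
`y n ∈ V n` such that `‖v ⊗ y₀ + ∑ i < n, x i ⊗ y i‖ > ‖v‖ + n - ε` for all `n`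
(`exists_seq_norm_add_sum_gt`).  A functional `G` norming this sum is almost maximal at each summand.
Since the `V n` are determining, `y₀` is almost a convex combination of finitely many `y i`; as
`Re G (v ⊗ y₀)` is almost `‖v‖`, so is `Re G (v ⊗ y i)` for one of them.  Together with
`Re G (x i ⊗ y i) ≈ 1` this gives `‖v + x i‖ ≈ ‖v‖ + 1` while `f (x i) ≈ 1`
(`exists_norm_add_gt_of_isSCD`), which is the Daugavet equation on `X` for the operator `f(·) v`.
-/

/-! ### Elementary tensors in the projective tensor product -/

namespace ProjectiveTensorProduct

variable {𝕜 X Y : Type*} [RCLike 𝕜] [NormedAddCommGroup X] [NormedSpace 𝕜 X]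
  [NormedAddCommGroup Y] [NormedSpace 𝕜 Y]

theorem norm_algTmul_le (x : X) (y : Y) : ‖AlgTensor.tmul 𝕜 x y‖ ≤ ‖x‖ * ‖y‖ :=
  csInf_le (AlgTensor.bddBelow_costs _) (AlgTensor.tmul_mem_costs x y)

variable (𝕜 X Y) in
/-- The canonical bilinear map `(x, y) ↦ x ⊗ y` into the projective tensor product, as a continuous
bilinear map. -/
noncomputable def tmulL : X →L[𝕜] Y →L[𝕜] ProjectiveTensorProduct 𝕜 X Y :=
  LinearMap.mkContinuous₂
    (LinearMap.mk₂ 𝕜 (fun x y => ((AlgTensor.tmul 𝕜 x y : AlgTensor 𝕜 X Y) :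
        ProjectiveTensorProduct 𝕜 X Y))
      (fun x x' y => by
        rw [← UniformSpace.Completion.coe_add]
        exact congrArg _ (TensorProduct.add_tmul x x' y))
      (fun c x y => by
        rw [← UniformSpace.Completion.coe_smul]
        exact congrArg _ (TensorProduct.smul_tmul' c x y).symm)
      (fun x y y' => by
        rw [← UniformSpace.Completion.coe_add]
        exact congrArg _ (TensorProduct.tmul_add x y y'))
      (fun c x y => by
        rw [← UniformSpace.Completion.coe_smul]
        exact congrArg _ (TensorProduct.tmul_smul c x y)))
    1 (fun x y => by
      rw [one_mul, LinearMap.mk₂_apply, UniformSpace.Completion.norm_coe]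
      exact norm_algTmul_le x y)

theorem tmulL_apply (x : X) (y : Y) :
    tmulL 𝕜 X Y x y = ((AlgTensor.tmul 𝕜 x y : AlgTensor 𝕜 X Y) :
      ProjectiveTensorProduct 𝕜 X Y) := rfl

theorem norm_tmulL_le (x : X) (y : Y) : ‖tmulL 𝕜 X Y x y‖ ≤ ‖x‖ * ‖y‖ := by
  rw [tmulL_apply, UniformSpace.Completion.norm_coe]
  exact norm_algTmul_le x y

/-- The elementary tensors norm every operator on the algebraic tensor product. -/
theorem norm_apply_le_of_tmul {F : Type*} [SeminormedAddCommGroup F] [NormedSpace 𝕜 F]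
    (W : AlgTensor 𝕜 X Y →ₗ[𝕜] F) {C : ℝ} (hC : 0 ≤ C)
    (h : ∀ x y, ‖W (AlgTensor.tmul 𝕜 x y)‖ ≤ C * (‖x‖ * ‖y‖)) (u : AlgTensor 𝕜 X Y) :
    ‖W u‖ ≤ C * ‖u‖ := by
  change _ ≤ C * sInf (AlgTensor.costs u)
  rw [← smul_eq_mul, ← Real.sInf_smul_of_nonneg hC]
  refine le_csInf ((AlgTensor.costs_nonempty u).smul_set) ?_
  rintro _ ⟨r, ⟨n, x, y, rfl, rfl⟩, rfl⟩
  rw [map_sum]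
  change _ ≤ C * _
  rw [Finset.mul_sum]
  exact norm_sum_le_of_le _ fun i _ => h (x i) (y i)

/-- The elementary tensors norm every operator on the projective tensor product. -/
theorem opNorm_le_of_tmulL {F : Type*} [SeminormedAddCommGroup F] [NormedSpace 𝕜 F]
    (W : ProjectiveTensorProduct 𝕜 X Y →L[𝕜] F) {C : ℝ} (hC : 0 ≤ C)
    (h : ∀ x y, ‖W (tmulL 𝕜 X Y x y)‖ ≤ C * (‖x‖ * ‖y‖)) : ‖W‖ ≤ C := by
  refine W.opNorm_le_bound hC fun z => ?_
  induction z using UniformSpace.Completion.induction_on with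
  | hp => exact isClosed_le (by fun_prop) (by fun_prop)
  | ih u =>
    rw [UniformSpace.Completion.norm_coe]
    exact norm_apply_le_of_tmul
      (W.toLinearMap ∘ₗ (UniformSpace.Completion.toComplL (𝕜 := 𝕜)).toLinearMap) hC h u

/-- An operator on the projective tensor product almost attains its norm at an elementary tensor of
two vectors of the closed unit balls. -/
theorem exists_lt_norm_apply_tmulL {F : Type*} [SeminormedAddCommGroup F] [NormedSpace 𝕜 F]
    (W : ProjectiveTensorProduct 𝕜 X Y →L[𝕜] F) {r : ℝ} (hr0 : 0 ≤ r) (hr : r < ‖W‖) :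
    ∃ (x : X) (y : Y), ‖x‖ ≤ 1 ∧ ‖y‖ ≤ 1 ∧ r < ‖W (tmulL 𝕜 X Y x y)‖ := by
  by_contra! hcon
  refine hr.not_ge (opNorm_le_of_tmulL W hr0 fun x y => ?_)
  rcases eq_or_ne x 0 with rfl | hx
  · simp
  rcases eq_or_ne y 0 with rfl | hy
  · simp
  have hx' := norm_pos_iff.2 hx
  have hy' := norm_pos_iff.2 hy
  have key := hcon (((‖x‖ : ℝ) : 𝕜)⁻¹ • x) (((‖y‖ : ℝ) : 𝕜)⁻¹ • y)
    (norm_smul_inv_norm hx).le (norm_smul_inv_norm hy).le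
  rw [map_smul, map_smul, map_smul, smul_apply, map_smul, norm_smul, norm_smul, norm_inv,
    norm_inv, RCLike.norm_ofReal, RCLike.norm_ofReal, abs_norm, abs_norm,
    inv_mul_le_iff₀ hy', inv_mul_le_iff₀ hx'] at key
  linarith

/-- The functional `f ⊗ g` on the projective tensor product. -/
theorem exists_tensor_functional (f : X →L[𝕜] 𝕜) (g : Y →L[𝕜] 𝕜) :
    ∃ φ : ProjectiveTensorProduct 𝕜 X Y →L[𝕜] 𝕜,
      (∀ x y, φ (tmulL 𝕜 X Y x y) = f x * g y) ∧ ‖φ‖ = ‖f‖ * ‖g‖ := by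
  let L : AlgTensor 𝕜 X Y →ₗ[𝕜] 𝕜 :=
    TensorProduct.lift (LinearMap.mk₂ 𝕜 (fun (x : X) (y : Y) => f x * g y)
      (fun x x' y => by rw [map_add, add_mul]) (fun c x y => by simp [mul_assoc])
      (fun x y y' => by rw [map_add, mul_add]) (fun c x y => by simp [mul_left_comm]))
  have hL : ∀ x y, L (AlgTensor.tmul 𝕜 x y) = f x * g y := fun x y => TensorProduct.lift.tmul x y
  have hbound : ∀ x y, ‖f x * g y‖ ≤ ‖f‖ * ‖g‖ * (‖x‖ * ‖y‖) := fun x y => by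
    rw [norm_mul]
    calc
      ‖f x‖ * ‖g y‖ ≤ (‖f‖ * ‖x‖) * (‖g‖ * ‖y‖) := by
        gcongr <;> exact ContinuousLinearMap.le_opNorm _ _
      _ = _ := by ring
  let L' : AlgTensor 𝕜 X Y →L[𝕜] 𝕜 := L.mkContinuous (‖f‖ * ‖g‖)
    (norm_apply_le_of_tmul L (by positivity) fun x y => by rw [hL]; exact hbound x y)
  let φ : ProjectiveTensorProduct 𝕜 X Y →L[𝕜] 𝕜 :=
    L'.extend (UniformSpace.Completion.toComplL (𝕜 := 𝕜))
  have hφ : ∀ x y, φ (tmulL 𝕜 X Y x y) = f x * g y := fun x y => by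
    rw [← hL, tmulL_apply]
    exact L'.extend_eq UniformSpace.Completion.denseRange_coe
      (UniformSpace.Completion.isUniformInducing_coe _) _
  refine ⟨φ, hφ, le_antisymm
    (opNorm_le_of_tmulL φ (by positivity) fun x y => by rw [hφ]; exact hbound x y) ?_⟩
  -- Testing `φ` on `x ⊗ y` bounds `‖f x‖ * ‖g‖` and then `‖f‖ * ‖g‖`.
  have h1 : ∀ x, ‖(f x) • g‖ ≤ ‖φ‖ * ‖x‖ := fun x =>
    ContinuousLinearMap.opNorm_le_bound _ (by positivity) fun y => by
      rw [smul_apply, smul_eq_mul, ← hφ, mul_assoc]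
      exact (φ.le_opNorm _).trans (by gcongr; exact norm_tmulL_le x y)
  rw [← ContinuousLinearMap.norm_smulRight_apply]
  exact ContinuousLinearMap.opNorm_le_bound _ (by positivity) h1

theorem norm_tmulL (x : X) (y : Y) : ‖tmulL 𝕜 X Y x y‖ = ‖x‖ * ‖y‖ := by
  refine le_antisymm (norm_tmulL_le x y) ?_
  rcases eq_or_ne x 0 with rfl | hx
  · simp
  rcases eq_or_ne y 0 with rfl | hy
  · simp
  obtain ⟨f, hf, hfx⟩ := exists_dual_vector 𝕜 x (norm_ne_zero_iff.2 hx)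
  obtain ⟨g, hg, hgy⟩ := exists_dual_vector 𝕜 y (norm_ne_zero_iff.2 hy)
  obtain ⟨φ, hφ, hφn⟩ := exists_tensor_functional f g
  have := φ.le_opNorm (tmulL 𝕜 X Y x y)
  rwa [hφ, hφn, hf, hg, hfx, hgy, norm_mul, RCLike.norm_ofReal, RCLike.norm_ofReal, abs_norm,
    abs_norm, one_mul, one_mul] at this

end ProjectiveTensorProduct

/-! ### Rank-one operators -/

section RankOne

variable {𝕜 E : Type*} [RCLike 𝕜] [NormedAddCommGroup E] [NormedSpace 𝕜 E]

theorem rank_smulRight_eq_one {f : E →L[𝕜] 𝕜} (hf : f ≠ 0) {v : E} (hv : v ≠ 0) :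
    ((f.smulRight v : E →L[𝕜] E) : E →ₗ[𝕜] E).rank = 1 := by
  obtain ⟨x, hx⟩ := DFunLike.ne_iff.1 hf
  refine (rank_submodule_eq_one_iff _).2 ⟨f x • v, ⟨x, rfl⟩, smul_ne_zero hx hv, ?_⟩
  rintro _ ⟨y, rfl⟩
  refine Submodule.mem_span_singleton.2 ⟨f y / f x, ?_⟩
  rw [smul_smul, div_mul_cancel₀ _ hx]
  rfl

theorem exists_eq_smulRight_of_rank_eq_one {T : E →L[𝕜] E}
    (hT : (T : E →ₗ[𝕜] E).rank = 1) :
    ∃ (f : E →L[𝕜] 𝕜) (v : E), ‖f‖ = 1 ∧ v ≠ 0 ∧ T = f.smulRight v := by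
  obtain ⟨⟨v, hvr⟩, hv0, hv⟩ := rank_eq_one_iff.1 hT
  replace hv0 : v ≠ 0 := fun h => hv0 (Subtype.ext h)
  have hv' : ∀ x, ∃ c : 𝕜, c • v = T x := fun x => by
    obtain ⟨c, hc⟩ := hv ⟨T x, x, rfl⟩
    exact ⟨c, congrArg Subtype.val hc⟩
  have hvn : ((‖v‖ : ℝ) : 𝕜) ≠ 0 := by simpa using hv0
  obtain ⟨h, -, hhv⟩ := exists_dual_vector 𝕜 v (norm_ne_zero_iff.2 hv0)
  -- The coefficient of `T x` along `v` is `h (T x) / ‖v‖`.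
  let f : E →L[𝕜] 𝕜 := ((‖v‖ : ℝ) : 𝕜)⁻¹ • h.comp T
  have hTf : T = f.smulRight v := by
    ext x
    obtain ⟨c, hc⟩ := hv' x
    simp [f, ← hc, hhv, mul_comm c, hvn]
  have hf0 : f ≠ 0 := by
    rintro h0
    obtain ⟨x, hx⟩ := hvr
    refine hv0 ?_
    rw [← hx]
    change T x = 0
    rw [hTf, h0]
    simp
  have hfn : ((‖f‖ : ℝ) : 𝕜) ≠ 0 := by simpa using hf0
  refine ⟨((‖f‖ : ℝ) : 𝕜)⁻¹ • f, ((‖f‖ : ℝ) : 𝕜) • v, norm_smul_inv_norm hf0,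
    smul_ne_zero hfn hv0, ?_⟩
  rw [hTf]
  ext x
  simp [smul_smul, hfn, mul_comm]

/-- A vector can be rotated so that a given functional takes a nonnegative real value at it. -/
theorem exists_unimodular_smul_apply_eq_norm (f : E →L[𝕜] 𝕜) (x : E) :
    ∃ c : 𝕜, ‖c‖ = 1 ∧ f (c • x) = (‖f x‖ : ℝ) := by
  obtain ⟨c, hc, h⟩ := RCLike.exists_norm_eq_mul_self (f x)
  exact ⟨c, hc, by rw [map_smul, smul_eq_mul, h]⟩

/-- To verify the Daugavet property it suffices to find, for each rank-one operator `f(·) v` with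
`‖f‖ = 1`, vectors `x` of the unit ball with `f x` almost `1` and `‖v + x‖` almost `‖v‖ + 1`. -/
theorem HasDaugavetProperty.of_exists_norm_add_gt
    (h : ∀ (f : E →L[𝕜] 𝕜) (v : E), ‖f‖ = 1 → v ≠ 0 → ∀ ε > 0,
      ∃ (x : E) (t : ℝ), ‖x‖ ≤ 1 ∧ f x = t ∧ 1 - ε < t ∧ t ≤ 1 ∧ ‖v‖ + 1 - ε < ‖v + x‖) :
    HasDaugavetProperty 𝕜 E := by
  intro T hT
  obtain ⟨f, v, hf, hv, rfl⟩ := exists_eq_smulRight_of_rank_eq_one hT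
  rw [ContinuousLinearMap.norm_smulRight_apply, hf, one_mul]
  refine le_antisymm ?_ (le_of_forall_pos_lt_add fun ε hε => ?_)
  · refine (norm_add_le _ _).trans (add_le_add ContinuousLinearMap.norm_id_le ?_)
    rw [ContinuousLinearMap.norm_smulRight_apply, hf, one_mul]
  · have hpos : 0 < 1 + ‖v‖ := by positivity
    obtain ⟨x, t, hx, hfx, ht, ht1, hvx⟩ := h f v hf hv (ε / (1 + ‖v‖)) (by positivity)
    have h1 : ‖x + (t : 𝕜) • v‖ ≤ ‖ContinuousLinearMap.id 𝕜 E + f.smulRight v‖ := by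
      have := (ContinuousLinearMap.id 𝕜 E + f.smulRight v).unit_le_opNorm x hx
      simpa [hfx] using this
    have h2 : v + x = (x + (t : 𝕜) • v) + ((1 - t : ℝ) : 𝕜) • v := by
      push_cast
      module
    have h3 : ‖v + x‖ ≤ ‖x + (t : 𝕜) • v‖ + (1 - t) * ‖v‖ := by
      rw [h2]
      refine (norm_add_le _ _).trans_eq ?_
      rw [norm_smul, RCLike.norm_ofReal, abs_of_nonneg (by linarith)]
    have h4 : (1 - t) * ‖v‖ ≤ ε / (1 + ‖v‖) * ‖v‖ := by gcongr; linarith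
    have h5 : ε / (1 + ‖v‖) * ‖v‖ + ε / (1 + ‖v‖) = ε := by field_simp; ring
    linarith

end RankOne

/-! ### The Daugavet property and elementary tensors -/

section Tensor

open ProjectiveTensorProduct

variable {𝕜 X Y : Type*} [RCLike 𝕜] [NormedAddCommGroup X] [NormedSpace 𝕜 X]
  [NormedAddCommGroup Y] [NormedSpace 𝕜 Y]

/-- The Daugavet property of `X ⊗̂ Y`, seen on elementary tensors: `Id + (f ⊗ g)(·) u` almost attains
its norm `1 + ‖u‖` at some `x ⊗ y`, and `x`, `y` can be rotated to make `f x` and `g y` real. -/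
theorem HasDaugavetProperty.exists_tmul_norm_add_gt
    (hXY : HasDaugavetProperty 𝕜 (ProjectiveTensorProduct 𝕜 X Y))
    {f : X →L[𝕜] 𝕜} (hf : ‖f‖ = 1) {g : Y →L[𝕜] 𝕜} (hg : ‖g‖ = 1)
    {u : ProjectiveTensorProduct 𝕜 X Y} (hu : u ≠ 0) {δ : ℝ} (hδ : 0 < δ) :
    ∃ (x : X) (y : Y) (t : ℝ), ‖x‖ ≤ 1 ∧ ‖y‖ ≤ 1 ∧ f x = t ∧ 1 - δ < t ∧
      1 - δ < RCLike.re (g y) ∧ ‖u‖ + 1 - δ < ‖u + tmulL 𝕜 X Y x y‖ := by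
  obtain ⟨φ, hφ, hφn⟩ := exists_tensor_functional f g
  rw [hf, hg, one_mul] at hφn
  have hφ0 : φ ≠ 0 := by
    rintro rfl
    simp at hφn
  have hup : 0 < ‖u‖ := norm_pos_iff.2 hu
  have hD := hXY (φ.smulRight u) (rank_smulRight_eq_one hφ0 hu)
  rw [ContinuousLinearMap.norm_smulRight_apply, hφn, one_mul] at hD
  -- The defect `η` costs `η / ‖u‖` in `|φ (x ⊗ y)|` and `2 η` in the norm of the sum.
  obtain ⟨η, hη, hη1, hη2, hη3⟩ : ∃ η : ℝ, 0 < η ∧ η ≤ δ * ‖u‖ ∧ 2 * η ≤ δ ∧ η ≤ 1 :=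
    ⟨min (δ * ‖u‖) (min (δ / 2) 1), by positivity, min_le_left _ _, by
      have := (min_le_right (δ * ‖u‖) (min (δ / 2) 1)).trans (min_le_left _ _)
      linarith, (min_le_right _ _).trans (min_le_right _ _)⟩
  obtain ⟨x, y, hx, hy, hxy⟩ := exists_lt_norm_apply_tmulL
    (ContinuousLinearMap.id 𝕜 (ProjectiveTensorProduct 𝕜 X Y) + φ.smulRight u)
    (r := 1 + ‖u‖ - η) (by linarith) (by rw [hD]; linarith)
  obtain ⟨a, ha, hax⟩ := exists_unimodular_smul_apply_eq_norm f x
  obtain ⟨b, hb, hby⟩ := exists_unimodular_smul_apply_eq_norm g y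
  have hx' : ‖a • x‖ ≤ 1 := by rwa [norm_smul, ha, one_mul]
  have hy' : ‖b • y‖ ≤ 1 := by rwa [norm_smul, hb, one_mul]
  have hfx : ‖f x‖ ≤ 1 := by simpa [hf] using f.unit_le_opNorm x hx
  have hgy : ‖g y‖ ≤ 1 := by simpa [hg] using g.unit_le_opNorm y hy
  set e := tmulL 𝕜 X Y (a • x) (b • y) with he
  set s := ‖f x‖ * ‖g y‖ with hs
  have he1 : ‖e‖ ≤ 1 :=
    (norm_tmulL_le _ _).trans (mul_le_one₀ hx' (norm_nonneg _) hy')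
  have hφe : φ e = ((s : ℝ) : 𝕜) := by
    rw [he, hφ, hax, hby, hs]
    push_cast
    rfl
  have hW : 1 + ‖u‖ - η < ‖e + (s : 𝕜) • u‖ := by
    have hab : e + (s : 𝕜) • u = (a * b) • ((ContinuousLinearMap.id 𝕜
        (ProjectiveTensorProduct 𝕜 X Y) + φ.smulRight u) (tmulL 𝕜 X Y x y)) := by
      rw [← hφe, ← map_smul]
      have : (a * b) • tmulL 𝕜 X Y x y = e := by
        simp [he, smul_smul, mul_comm]
      rw [this]
      simp
    rwa [hab, norm_smul, norm_mul, ha, hb, one_mul, one_mul]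
  have hs1 : s ≤ 1 := mul_le_one₀ hfx (norm_nonneg _) hgy
  have hs0 : 0 ≤ s := by positivity
  have hsu : ‖e + (s : 𝕜) • u‖ ≤ 1 + s * ‖u‖ := by
    refine (norm_add_le _ _).trans (add_le_add he1 ?_)
    rw [norm_smul, RCLike.norm_ofReal, abs_of_nonneg hs0]
  have hsδ : 1 - δ < s := by
    have : 0 < (s - (1 - δ)) * ‖u‖ := by linarith
    linarith [pos_of_mul_pos_left this hup.le]
  have hsf : s ≤ ‖f x‖ := mul_le_of_le_one_right (norm_nonneg _) hgy
  have hsg : s ≤ ‖g y‖ := mul_le_of_le_one_left (norm_nonneg _) hfx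
  refine ⟨a • x, b • y, ‖f x‖, hx', hy', hax, by linarith, ?_, ?_⟩
  · rw [hby, RCLike.ofReal_re]
    linarith
  · have h2 : e + (s : 𝕜) • u = (u + e) - ((1 - s : ℝ) : 𝕜) • u := by
      push_cast
      module
    have h3 : ‖e + (s : 𝕜) • u‖ ≤ ‖u + e‖ + (1 - s) * ‖u‖ := by
      rw [h2]
      refine (norm_sub_le _ _).trans_eq ?_
      rw [norm_smul, RCLike.norm_ofReal, abs_of_nonneg (by linarith)]
    linarith

/-- Every slice of the unit ball contains a slice given by a functional of norm one. -/
theorem IsSlice.exists_norm_eq_one [Nontrivial Y] {V : Set Y}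
    (hV : IsSlice 𝕜 (Metric.closedBall (0 : Y) 1) V) :
    ∃ (g : Y →L[𝕜] 𝕜) (δ : ℝ), ‖g‖ = 1 ∧ 0 < δ ∧
      ∀ y, ‖y‖ ≤ 1 → 1 - δ < RCLike.re (g y) → y ∈ V := by
  obtain ⟨⟨z, hz⟩, g, c, rfl⟩ := hV
  obtain ⟨hz1, hzc⟩ := hz
  rw [mem_closedBall_zero_iff] at hz1
  rcases eq_or_ne g 0 with rfl | hg
  · -- The slice is the whole ball.
    obtain ⟨y, hy⟩ := exists_ne (0 : Y)
    obtain ⟨g, hg, -⟩ := exists_dual_vector 𝕜 y (norm_ne_zero_iff.2 hy)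
    exact ⟨g, 1, hg, one_pos, fun y hy _ =>
      ⟨mem_closedBall_zero_iff.2 hy, by simpa using hzc⟩⟩
  · have hgp : 0 < ‖g‖ := norm_pos_iff.2 hg
    have hc : c < ‖g‖ := hzc.trans_le
      (((RCLike.re_le_norm _).trans (g.unit_le_opNorm z hz1)))
    refine ⟨((‖g‖ : ℝ) : 𝕜)⁻¹ • g, 1 - c / ‖g‖, norm_smul_inv_norm hg, ?_, fun y hy hgy =>
      ⟨mem_closedBall_zero_iff.2 hy, ?_⟩⟩
    · rw [sub_pos, div_lt_one hgp]
      exact hc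
    · rw [sub_sub_cancel, smul_apply, smul_eq_mul, ← RCLike.ofReal_inv,
        RCLike.re_ofReal_mul, div_eq_inv_mul] at hgy
      exact lt_of_mul_lt_mul_left hgy (inv_nonneg.2 hgp.le)

/-- Given slices `V n` of the unit ball of `Y`, there are `x n` with `f (x n)` almost `1` and
`y n ∈ V n` such that all sums `u + ∑ i < n, x i ⊗ y i` have almost the maximal norm. -/
theorem exists_seq_norm_add_sum_gt [Nontrivial Y]
    (hXY : HasDaugavetProperty 𝕜 (ProjectiveTensorProduct 𝕜 X Y))
    {V : ℕ → Set Y} (hV : ∀ n, IsSlice 𝕜 (Metric.closedBall (0 : Y) 1) (V n))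
    {f : X →L[𝕜] 𝕜} (hf : ‖f‖ = 1) {u : ProjectiveTensorProduct 𝕜 X Y} {ε : ℝ} (hε : 0 < ε)
    (hεu : ε < ‖u‖) :
    ∃ (x : ℕ → X) (y : ℕ → Y), (∀ n, ‖x n‖ ≤ 1) ∧ (∀ n, y n ∈ V n) ∧
      (∀ n, ∃ t : ℝ, f (x n) = t ∧ 1 - ε < t) ∧
      ∀ n : ℕ, ‖u‖ + n - ε < ‖u + ∑ i ∈ Finset.range n, tmulL 𝕜 X Y (x i) (y i)‖ := by
  have step : ∀ (n : ℕ) (w : {w : ProjectiveTensorProduct 𝕜 X Y // ‖u‖ + n - ε < ‖w‖}),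
      ∃ p : X × Y, ‖p.1‖ ≤ 1 ∧ p.2 ∈ V n ∧ (∃ t : ℝ, f p.1 = t ∧ 1 - ε < t) ∧
        ‖u‖ + (n + 1 : ℕ) - ε < ‖w.1 + tmulL 𝕜 X Y p.1 p.2‖ := by
    rintro n ⟨w, hw⟩
    obtain ⟨g, δ, hg, hδ, hgV⟩ := (hV n).exists_norm_eq_one
    have hw0 : w ≠ 0 := by
      rw [← norm_pos_iff]
      have : (0 : ℝ) ≤ n := n.cast_nonneg
      linarith
    -- The bound for `w` is strict, so there is room for a positive loss in the next step.
    obtain ⟨x, y, t, hx, hy, hfx, ht, hgy, hn⟩ := hXY.exists_tmul_norm_add_gt hf hg hw0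
      (δ := min (min ε δ) (‖w‖ - (‖u‖ + n - ε)))
      (lt_min (lt_min hε hδ) (by linarith))
    have h1 := min_le_left (min ε δ) (‖w‖ - (‖u‖ + n - ε))
    have h2 := min_le_right (min ε δ) (‖w‖ - (‖u‖ + n - ε))
    have h3 := min_le_left ε δ
    have h4 := min_le_right ε δ
    refine ⟨(x, y), hx, hgV y hy (by linarith), ⟨t, hfx, by linarith⟩, ?_⟩
    push_cast
    linarith
  choose p hp1 hpV hpf hpn using step
  let w : (n : ℕ) → {w : ProjectiveTensorProduct 𝕜 X Y // ‖u‖ + n - ε < ‖w‖} :=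
    fun n => Nat.rec ⟨u, by simpa using hε⟩
      (fun n w => ⟨w.1 + tmulL 𝕜 X Y (p n w).1 (p n w).2, hpn n w⟩) n
  have hw : ∀ n, (w n).1 = u + ∑ i ∈ Finset.range n,
      tmulL 𝕜 X Y (p i (w i)).1 (p i (w i)).2 := by
    intro n
    induction n with
    | zero => simp [w]
    | succ n ih =>
      rw [Finset.sum_range_succ, ← add_assoc, ← ih]
  exact ⟨fun n => (p n (w n)).1, fun n => (p n (w n)).2, fun n => hp1 n _, fun n => hpV n _,
    fun n => hpf n _, fun n => by rw [← hw]; exact (w n).2⟩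

/-- A point of the convex hull of a sequence is in the convex hull of an initial segment. -/
theorem exists_mem_convexHull_image_range {E : Type*} [AddCommGroup E] [Module ℝ E] {y : ℕ → E}
    {z : E} (hz : z ∈ convexHull ℝ (Set.range y)) :
    ∃ N : ℕ, z ∈ convexHull ℝ (y '' {i | i < N}) := by
  have hU : Set.range y = ⋃ N : ℕ, y '' {i | i < N} := by
    ext w
    simp only [Set.mem_range, Set.mem_iUnion, Set.mem_image, Set.mem_ofPred_eq]
    exact ⟨fun ⟨i, hi⟩ => ⟨i + 1, i, i.lt_succ_self, hi⟩, fun ⟨_, i, _, hi⟩ => ⟨i, hi⟩⟩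
  have hmono : Monotone fun N : ℕ => y '' {i | i < N} := fun a b hab =>
    Set.image_mono fun i (hi : i < a) => hi.trans_le hab
  have hconv : Convex ℝ (⋃ N : ℕ, convexHull ℝ (y '' {i | i < N})) :=
    Directed.convex_iUnion (Monotone.directed_le fun a b hab => convexHull_mono (hmono hab))
      fun _ => convex_convexHull ℝ _
  exact Set.mem_iUnion.1 (convexHull_min
    (hU ▸ Set.iUnion_mono fun N => subset_convexHull ℝ _) hconv hz)

/-- The transfer from `X ⊗̂ Y` to `X`. In the loss `3 * ε`, one `ε` comes from `G (v ⊗ y₀)`, one from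
the approximation of `y₀` by a convex combination, and one from `G (x i ⊗ y i)`. -/
theorem exists_norm_add_gt_of_isSCD [Nontrivial Y]
    (hY : IsSCD 𝕜 (Metric.closedBall (0 : Y) 1))
    (hXY : HasDaugavetProperty 𝕜 (ProjectiveTensorProduct 𝕜 X Y))
    {f : X →L[𝕜] 𝕜} (hf : ‖f‖ = 1) {v : X} {ε : ℝ} (hε : 0 < ε) (hεv : ε < ‖v‖) :
    ∃ (x : X) (t : ℝ), ‖x‖ ≤ 1 ∧ f x = t ∧ 1 - ε < t ∧ ‖v‖ + 1 - 3 * ε < ‖v + x‖ := by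
  obtain ⟨-, V, hV, hVsub, hdet⟩ := hY
  obtain ⟨y₀, hy₀⟩ : ∃ y : Y, ‖y‖ = 1 := by
    obtain ⟨y, hy⟩ := exists_ne (0 : Y)
    exact ⟨_, norm_smul_inv_norm (𝕜 := 𝕜) hy⟩
  have hu : ‖tmulL 𝕜 X Y v y₀‖ = ‖v‖ := by rw [norm_tmulL, hy₀, mul_one]
  obtain ⟨x, y, hx, hyV, hxf, hsum⟩ :=
    exists_seq_norm_add_sum_gt hXY hV hf (u := tmulL 𝕜 X Y v y₀) hε (hu ▸ hεv)
  rw [hu] at hsum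
  have hy : ∀ n, ‖y n‖ ≤ 1 := fun n => mem_closedBall_zero_iff.1 (hVsub n (hyV n))
  let _ : NormedSpace ℝ Y := NormedSpace.restrictScalars ℝ 𝕜 Y
  have hmem : y₀ ∈ closure (convexHull ℝ (Set.range y)) :=
    hdet (Set.range y) (by rintro _ ⟨n, rfl⟩; exact hVsub n (hyV n))
      (fun n => ⟨y n, ⟨n, rfl⟩, hyV n⟩) (mem_closedBall_zero_iff.2 hy₀.le)
  obtain ⟨z, hz, hzy⟩ := Metric.mem_closure_iff.1 hmem (ε / ‖v‖) (by
    have := hε.trans hεv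
    positivity)
  obtain ⟨N, hzN⟩ := exists_mem_convexHull_image_range hz
  obtain ⟨G, hG1, hGS⟩ := exists_dual_vector'' 𝕜
    (tmulL 𝕜 X Y v y₀ + ∑ i ∈ Finset.range N, tmulL 𝕜 X Y (x i) (y i))
  have hGle : ∀ w, RCLike.re (G w) ≤ ‖w‖ := fun w =>
    ((RCLike.re_le_norm _).trans (G.le_opNorm w)).trans
      (mul_le_of_le_one_left (norm_nonneg _) hG1)
  have hGe : ∀ i, RCLike.re (G (tmulL 𝕜 X Y (x i) (y i))) ≤ 1 := fun i =>
    ((hGle _).trans (norm_tmulL_le _ _)).trans (mul_le_one₀ (hx i) (norm_nonneg _) (hy i))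
  have hGv : RCLike.re (G (tmulL 𝕜 X Y v y₀)) ≤ ‖v‖ := hu ▸ hGle _
  have hGsum : ‖v‖ + N - ε < RCLike.re (G (tmulL 𝕜 X Y v y₀)) +
      ∑ i ∈ Finset.range N, RCLike.re (G (tmulL 𝕜 X Y (x i) (y i))) := by
    have h := congrArg RCLike.re hGS
    rw [RCLike.ofReal_re, map_add, map_sum, map_add, map_sum] at h
    rw [h]
    exact hsum N
  -- Each summand is almost maximal because the whole sum is.
  have hGv' : ‖v‖ - ε < RCLike.re (G (tmulL 𝕜 X Y v y₀)) := by
    have : ∑ i ∈ Finset.range N, RCLike.re (G (tmulL 𝕜 X Y (x i) (y i))) ≤ N := by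
      simpa using Finset.sum_le_sum fun i (_ : i ∈ Finset.range N) => hGe i
    linarith
  have hGe' : ∀ i < N, 1 - ε < RCLike.re (G (tmulL 𝕜 X Y (x i) (y i))) := by
    intro i hi
    have hi' := Finset.mem_range.2 hi
    have h := Finset.add_sum_erase _ (fun i => RCLike.re (G (tmulL 𝕜 X Y (x i) (y i)))) hi'
    have h' : ∑ j ∈ (Finset.range N).erase i, RCLike.re (G (tmulL 𝕜 X Y (x j) (y j))) ≤ N - 1 := by
      refine (Finset.sum_le_sum fun j _ => hGe j).trans_eq ?_
      rw [Finset.sum_const, Finset.card_erase_of_mem hi', Finset.card_range, nsmul_eq_mul, mul_one,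
        Nat.cast_pred (by omega)]
    linarith
  have hGz : ‖v‖ - 2 * ε < RCLike.re (G (tmulL 𝕜 X Y v z)) := by
    have h : RCLike.re (G (tmulL 𝕜 X Y v (y₀ - z))) ≤ ε := by
      refine ((hGle _).trans (norm_tmulL_le _ _)).trans ?_
      rw [dist_eq_norm, lt_div_iff₀ (hε.trans hεv)] at hzy
      linarith
    rw [map_sub, map_sub, map_sub] at h
    linarith
  obtain ⟨i, hi, hGi⟩ : ∃ i < N, ‖v‖ - 2 * ε < RCLike.re (G (tmulL 𝕜 X Y v (y i))) := by
    by_contra! hcon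
    refine hGz.not_ge ?_
    have hconv : Convex ℝ {w : Y | RCLike.re (G (tmulL 𝕜 X Y v w)) ≤ ‖v‖ - 2 * ε} := by
      refine convex_halfSpace_le (f := fun w => RCLike.re (G (tmulL 𝕜 X Y v w)))
        ⟨fun a b => by simp only [map_add], fun c a => ?_⟩ _
      change RCLike.re (G (tmulL 𝕜 X Y v ((algebraMap ℝ 𝕜 c) • a))) = _
      rw [map_smul, map_smul, smul_eq_mul, RCLike.algebraMap_eq_ofReal, RCLike.re_ofReal_mul,
        smul_eq_mul]
    exact convexHull_min (by rintro _ ⟨i, hi, rfl⟩; exact hcon i hi) hconv hzN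
  obtain ⟨t, hft, ht⟩ := hxf i
  refine ⟨x i, t, hx i, hft, ht, ?_⟩
  have h1 : RCLike.re (G (tmulL 𝕜 X Y (v + x i) (y i))) ≤ ‖v + x i‖ :=
    ((hGle _).trans (norm_tmulL_le _ _)).trans (mul_le_of_le_one_right (norm_nonneg _) (hy i))
  rw [map_add, add_apply, map_add, map_add] at h1
  linarith [hGe' i hi]

end Tensor

theorem mainTheorem4 {𝕜 : Type*} [RCLike 𝕜]
    {X : Type*} [NormedAddCommGroup X] [NormedSpace 𝕜 X] [CompleteSpace X]
    {Y : Type*} [NormedAddCommGroup Y] [NormedSpace 𝕜 Y] [CompleteSpace Y] [Nontrivial Y]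
    (hY : IsSCD 𝕜 (Metric.closedBall (0 : Y) 1))
    (hXY : HasDaugavetProperty 𝕜 (ProjectiveTensorProduct 𝕜 X Y)) :
    HasDaugavetProperty 𝕜 X := by
  refine HasDaugavetProperty.of_exists_norm_add_gt fun f v hf hv ε hε => ?_
  have hvp : 0 < ‖v‖ := norm_pos_iff.2 hv
  have h1 : min (ε / 3) (‖v‖ / 2) ≤ ε / 3 := min_le_left _ _
  have h2 : min (ε / 3) (‖v‖ / 2) ≤ ‖v‖ / 2 := min_le_right _ _
  obtain ⟨x, t, hx, hfx, ht, hvx⟩ := exists_norm_add_gt_of_isSCD hY hXY hf (v := v)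
    (ε := min (ε / 3) (‖v‖ / 2)) (by positivity) (by linarith)
  refine ⟨x, t, hx, hfx, by linarith, ?_, by linarith⟩
  have h := (RCLike.re_le_norm (f x)).trans (f.unit_le_opNorm x hx)
  rwa [hfx, hf, RCLike.ofReal_re] at h
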